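/- Graphs are simple and undirected. The vertex set of a connected graph carries the path length metric. Two connected graphs $\Gamma,\Delta$ are bilipschitz equivalent if there are a bijection $f : V(\Gamma)\to V(\Delta)$ and a constant $c>0$ with $\frac1c\, d_\Gamma(x,y)\le d_\Delta(f(x),f(y))\le c\, d_\Gamma(x,y)$ for all $x,y\in V(\Gamma)$. A Hamiltonian path of a graph $\Delta$ is a map $P : I\to V(\Delta)$ from a finite or infinite interval $I\subseteq\mathbb Z$ such that $P(i)$ and $P(i+1)$ are adjacent whenever $i,i+1\in I$ and every vertex is visited precisely once; it is bi-infinite if $I=\mathbb Z$. The number of ends of a connected graph $\Gamma$ is the supremum, over the finite sets $A\subseteq E(\Gamma)$, of the number of infinite connected components of $\Gamma-A$. A right action $*$ of $\mathbb Z$ on $V(\Gamma)$ is translation-like if it is free ($x*n=x$ for some $x$ implies $n=0$) and for every $n\in\mathbb Z$ the set $\{d_\Gamma(x,x*n): x\in V(\Gamma)\}$ is bounded. **Theorem.** Let $\Gamma$ be a connected graph whose vertices have uniformly bounded degree. 1. $\Gamma$ is bilipschitz equivalent to a graph admitting a Hamiltonian path if and only if $\Gamma$ has at most two ends. 2. If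 $\Gamma$ is infinite, then $\Gamma$ is bilipschitz equivalent to a graph admitting a bi-infinite Hamiltonian path if and only if $\Gamma$ has at most two ends. 3. If $\Gamma$ is infinite, then $\Gamma$ admits a transitive translation-like action by $\mathbb Z$ if and only if $\Gamma$ has at most two ends. -/

import Mathlib

universe u

namespace SimpleGraph

/-- The degrees of the vertices are finite and uniformly bounded. -/
def UniformlyBoundedDegree {V : Type u} (Γ : SimpleGraph V) : Prop :=
  ∃ D : ℕ, ∀ v : V, (Γ.neighborSet v).encard ≤ (D : ℕ∞)

/-- The number of ends: the supremum, over all finite sets `A` of edges, of the number of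
infinite connected components of `Γ - A`. -/
noncomputable def numEnds {V : Type u} (Γ : SimpleGraph V) : ℕ∞ :=
  ⨆ (A : Set (Sym2 V)) (_ : A ⊆ Γ.edgeSet) (_ : A.Finite),
    {C : (Γ.deleteEdges A).ConnectedComponent | C.supp.Infinite}.encard

/-- A map between the vertex sets of two graphs is bilipschitz for the path length metrics. -/
def IsBilipschitz {V W : Type u} (Γ : SimpleGraph V) (Δ : SimpleGraph W) (f : V → W) : Prop :=
  ∃ c : ℝ, 0 < c ∧ ∀ x y : V,
    (Δ.dist (f x) (f y) : ℝ) ≤ c * (Γ.dist x y : ℝ) ∧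
    (1 / c) * (Γ.dist x y : ℝ) ≤ (Δ.dist (f x) (f y) : ℝ)

/-- Bilipschitz equivalence of graphs. Both graphs have to be connected, since only then is the
path length distance a metric on the vertex set. -/
def BilipschitzEquivalent {V W : Type u} (Γ : SimpleGraph V) (Δ : SimpleGraph W) : Prop :=
  Γ.Connected ∧ Δ.Connected ∧ ∃ f : V → W, Function.Bijective f ∧ IsBilipschitz Γ Δ f

/-- A Hamiltonian path: a function from a (finite or infinite) interval `I` of integers to the
vertices which sends consecutive integers to adjacent vertices and which visits every vertex
precisely one time. -/
structure IsHamiltonianPath {V : Type u} (Γ : SimpleGraph V) (I : Set ℤ) (P : I → V) : Prop where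
  interval : I.OrdConnected
  adj : ∀ i j : I, (j : ℤ) = (i : ℤ) + 1 → Γ.Adj (P i) (P j)
  visits_once : ∀ v : V, ∃! i : I, P i = v

/-- The graph admits a Hamiltonian path (finite, one-sided infinite or bi-infinite). -/
def AdmitsHamiltonianPath {V : Type u} (Γ : SimpleGraph V) : Prop :=
  ∃ (I : Set ℤ) (P : I → V), Γ.IsHamiltonianPath I P

/-- The graph admits a bi-infinite Hamiltonian path, that is, one whose domain is all of `ℤ`. -/
def AdmitsBiinfiniteHamiltonianPath {V : Type u} (Γ : SimpleGraph V) : Prop :=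
  ∃ P : ↥(Set.univ : Set ℤ) → V, Γ.IsHamiltonianPath Set.univ P

/-- A right action of an (additively written) group `H` on the vertices of `Γ` is translation-like
if it is free and every `h` moves all vertices by a bounded distance. The vertex `x * h` is
written `AddOpposite.op h +ᵥ x`. -/
structure IsTranslationLike {V : Type u} (Γ : SimpleGraph V) (H : Type*) [AddGroup H]
    [AddAction Hᵃᵒᵖ V] : Prop where
  free : ∀ (x : V) (h : H), AddOpposite.op h +ᵥ x = x → h = 0
  bounded : ∀ h : H, BddAbove (Set.range fun x : V => Γ.dist x (AddOpposite.op h +ᵥ x))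

/-- The graph admits a translation-like right action of `ℤ` which is transitive on vertices. -/
def AdmitsTransitiveTranslationLikeIntAction {V : Type u} (Γ : SimpleGraph V) : Prop :=
  ∃ _ : AddAction ℤᵃᵒᵖ V, Γ.IsTranslationLike ℤ ∧ AddAction.IsPretransitive ℤᵃᵒᵖ V

end SimpleGraph

/-! Every condition amounts to listing the vertices, each once, along an interval of `ℤ` with
bounded distance between consecutive terms. Such a listing becomes a Hamiltonian path once all
sufficiently close vertices are joined, and a bi-infinite one carries the translation action of `ℤ`;
conversely, Hamiltonian paths and orbits give listings.

A listing forces at most two ends: after finitely many edges are deleted, consecutive terms stay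
joined except at finitely many indices, so each tail lies in a single component
(`Connected.numEnds_le_two_of_seq`).

For the converse, a finite connected set can be toured by jumps of length at most three, with
control of both endpoints (`CutConnected.exists_list`). A one-ended set is exhausted by finite
connected pieces, each removed so that the rest stays connected (`IsOneEndedSet.exists_piece`);
their tours concatenate to a one-sided sequence. At most two ends exclude three disjoint infinite
sets with finite boundary. Hence an infinite graph either is one-ended, and its sequence is folded
into a line by parity, or consists, up to finitely many vertices, of two one-ended sets, whose
sequences are joined back to back (`Connected.exists_int_seq`). -/

namespace SimpleGraph

variable {V : Type u} {Γ : SimpleGraph V}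

/-! ### Connected vertex sets and components -/

/-- Every partition of `S` into two nonempty parts is crossed by an edge of the graph. -/
def CutConnected (Γ : SimpleGraph V) (S : Set V) : Prop :=
  ∀ X ⊆ S, X.Nonempty → (S \ X).Nonempty → ∃ a ∈ X, ∃ b ∈ S \ X, Γ.Adj a b

/-- Only finitely many edges leave the set `X`. -/
def FiniteBoundary (Γ : SimpleGraph V) (X : Set V) : Prop :=
  {p : V × V | p.1 ∈ X ∧ p.2 ∉ X ∧ Γ.Adj p.1 p.2}.Finite

/-- The vertices that can be reached from `x` by a walk whose later vertices lie in `X`. -/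
def componentIn (Γ : SimpleGraph V) (X : Set V) (x : V) : Set V :=
  {z | Relation.ReflTransGen (fun a b => Γ.Adj a b ∧ b ∈ X) x z}

/-- Adjacency is symmetric, so it is enough to test the side of each cut that contains a fixed
vertex. -/
theorem cutConnected_of_base {S : Set V} (s : V)
    (h : ∀ X ⊆ S, s ∈ X → (S \ X).Nonempty → ∃ a ∈ X, ∃ b ∈ S \ X, Γ.Adj a b)
    (hs : s ∈ S) : Γ.CutConnected S := by
  intro X hX hne hne'
  by_cases hsX : s ∈ X
  · exact h X hX hsX hne'
  · obtain ⟨a, ha, b, hb, hab⟩ := h (S \ X) Set.sdiff_subset ⟨hs, hsX⟩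
      (by rwa [Set.sdiff_sdiff_cancel_left hX])
    rw [Set.sdiff_sdiff_cancel_left hX] at hb
    exact ⟨b, hb, a, ha, hab.symm⟩

/-- Induction along edges: otherwise the part where `p` holds would be a cut that no edge crosses.
-/
theorem CutConnected.forall_mem {S : Set V} (hS : Γ.CutConnected S) {p : V → Prop} {s : V}
    (hs : s ∈ S) (hp : p s) (hstep : ∀ a ∈ S, ∀ b ∈ S, p a → Γ.Adj a b → p b) :
    ∀ z ∈ S, p z := by
  by_contra! hcon
  obtain ⟨z, hz, hpz⟩ := hcon
  obtain ⟨a, ha, b, hb, hab⟩ := hS {a ∈ S | p a} (fun a ha => ha.1) ⟨s, hs, hp⟩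
    ⟨z, hz, fun h => hpz h.2⟩
  exact hb.2 ⟨hb.1, hstep a ha.1 b hb.1 ha.2 hab⟩

theorem cutConnected_singleton (x : V) : Γ.CutConnected {x} := by
  intro X hX ⟨a, ha⟩ ⟨b, hb, hbX⟩
  have := hX ha
  simp only [Set.mem_singleton_iff] at this hb
  subst this hb
  exact absurd ha hbX

theorem CutConnected.insert_adj {S : Set V} (hS : Γ.CutConnected S) {a b : V} (ha : a ∈ S)
    (hab : Γ.Adj a b) : Γ.CutConnected (insert b S) := by
  refine cutConnected_of_base a (fun X hX haX hne => ?_) (Set.mem_insert_of_mem _ ha)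
  by_cases hbX : b ∈ X
  · obtain ⟨z, hz, hzX⟩ := hne
    have hzS : z ∈ S := hz.resolve_left (by rintro rfl; exact hzX hbX)
    obtain ⟨c, hc, d, hd, hcd⟩ := hS (X ∩ S) Set.inter_subset_right ⟨a, haX, ha⟩
      ⟨z, hzS, fun h => hzX h.1⟩
    exact ⟨c, hc.1, d, ⟨Or.inr hd.1, fun h => hd.2 ⟨h, hd.1⟩⟩, hcd⟩
  · exact ⟨a, haX, b, ⟨Set.mem_insert _ _, hbX⟩, hab⟩

theorem Connected.cutConnected_univ (h : Γ.Connected) : Γ.CutConnected Set.univ := by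
  intro X _ ⟨a, ha⟩ ⟨b, _, hb⟩
  obtain ⟨w⟩ := h.preconnected a b
  obtain ⟨d, _, hd, hd'⟩ := w.exists_boundary_dart X ha hb
  exact ⟨d.fst, hd, d.snd, ⟨trivial, hd'⟩, d.adj⟩

/-- Two vertices of a connected set lie in a finite connected subset. -/
theorem CutConnected.exists_finite_subset {S : Set V} (hS : Γ.CutConnected S) {x y : V}
    (hx : x ∈ S) (hy : y ∈ S) :
    ∃ B ⊆ S, B.Finite ∧ Γ.CutConnected B ∧ x ∈ B ∧ y ∈ B := by
  refine hS.forall_mem (p := fun y => ∃ B ⊆ S, B.Finite ∧ Γ.CutConnected B ∧ x ∈ B ∧ y ∈ B)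
    hx ⟨{x}, by simpa using hx, Set.finite_singleton x, cutConnected_singleton x, rfl, rfl⟩
    ?_ y hy
  rintro a _ b hb ⟨B, hB, hfin, hcon, hxB, haB⟩ hab
  exact ⟨insert b B, Set.insert_subset hb hB, hfin.insert b, hcon.insert_adj haB hab,
    Or.inr hxB, Or.inl rfl⟩

section Component

variable {X : Set V} {x y : V}

theorem mem_componentIn_self : x ∈ Γ.componentIn X x := Relation.ReflTransGen.refl

theorem componentIn_subset (hx : x ∈ X) : Γ.componentIn X x ⊆ X := by
  intro z hz
  induction hz with
  | refl => exact hx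
  | tail _ h _ => exact h.2

theorem componentIn_closed {a b : V} (ha : a ∈ Γ.componentIn X x) (hab : Γ.Adj a b)
    (hb : b ∈ X) : b ∈ Γ.componentIn X x :=
  Relation.ReflTransGen.tail ha ⟨hab, hb⟩

theorem mem_componentIn_symm (hx : x ∈ X) (hy : y ∈ Γ.componentIn X x) :
    x ∈ Γ.componentIn X y := by
  have key : ∀ z ∈ Γ.componentIn X x, z ∈ X ∧ x ∈ Γ.componentIn X z := by
    intro z hz
    induction hz with
    | refl => exact ⟨hx, mem_componentIn_self⟩
    | tail _ h ih => exact ⟨h.2, Relation.ReflTransGen.head ⟨h.1.symm, ih.1⟩ ih.2⟩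
  exact (key y hy).2

theorem cutConnected_componentIn : Γ.CutConnected (Γ.componentIn X x) := by
  refine cutConnected_of_base x (fun Y hY hxY hne => ?_) mem_componentIn_self
  by_contra! hcon
  obtain ⟨z, hz, hzY⟩ := hne
  refine hzY ?_
  induction hz with
  | refl => exact hxY
  | tail h h' ih =>
    by_contra hb
    exact hcon _ (by by_contra hn; exact hn (ih hn)) _ ⟨h.tail h', hb⟩ h'.1

end Component

/-! ### Sets with finite edge boundary -/

section Boundary

theorem FiniteBoundary.compl {X : Set V} (h : Γ.FiniteBoundary X) : Γ.FiniteBoundary Xᶜ := by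
  refine (h.image Prod.swap).subset ?_
  rintro ⟨a, b⟩ ⟨ha, hb, hab⟩
  exact ⟨(b, a), ⟨not_not.mp hb, ha, hab.symm⟩, rfl⟩

theorem FiniteBoundary.inter {X Y : Set V} (hX : Γ.FiniteBoundary X) (hY : Γ.FiniteBoundary Y) :
    Γ.FiniteBoundary (X ∩ Y) := by
  refine (hX.union hY).subset ?_
  rintro ⟨a, b⟩ ⟨ha, hb, hab⟩
  by_cases hbX : b ∈ X
  · exact Or.inr ⟨ha.2, fun h => hb ⟨hbX, h⟩, hab⟩
  · exact Or.inl ⟨ha.1, hbX, hab⟩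

theorem FiniteBoundary.diff {X Y : Set V} (hX : Γ.FiniteBoundary X) (hY : Γ.FiniteBoundary Y) :
    Γ.FiniteBoundary (X \ Y) := hX.inter hY.compl

theorem finiteBoundary_univ : Γ.FiniteBoundary Set.univ := by
  simp [FiniteBoundary]

theorem finiteBoundary_of_finite (hfin : ∀ v, (Γ.neighborSet v).Finite) {X : Set V}
    (hX : X.Finite) : Γ.FiniteBoundary X := by
  refine (hX.biUnion fun a _ => (hfin a).image (Prod.mk a)).subset ?_
  rintro ⟨a, b⟩ ⟨ha, _, hab⟩
  exact Set.mem_biUnion ha ⟨b, hab, rfl⟩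

/-- An infinite set with finite boundary has an infinite connected component. -/
theorem Connected.exists_infinite_component (hΓ : Γ.Connected) {X : Set V} (hX : X.Infinite)
    (hb : Γ.FiniteBoundary X) :
    ∃ C ⊆ X, C.Infinite ∧ Γ.CutConnected C ∧ Γ.FiniteBoundary C ∧
      ∀ a ∈ C, ∀ b ∈ X, Γ.Adj a b → b ∈ C := by
  by_cases huniv : X = Set.univ
  · subst huniv
    exact ⟨_, subset_rfl, hX, hΓ.cutConnected_univ, hb, fun _ _ _ _ _ => trivial⟩
  obtain ⟨w, hw⟩ := (Set.ne_univ_iff_exists_notMem X).mp huniv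
  set F := Prod.fst '' {p : V × V | p.1 ∈ X ∧ p.2 ∉ X ∧ Γ.Adj p.1 p.2} with hF
  have hFX : F ⊆ X := by rintro _ ⟨p, hp, rfl⟩; exact hp.1
  -- By connectedness of `Γ`, each component of `X` has an edge leaving it, which must leave `X`
  -- too. So the finitely many components of points of `F` cover `X`.
  have hcov : X ⊆ ⋃ a ∈ F, Γ.componentIn X a := by
    intro z hz
    have hsub := Γ.componentIn_subset hz
    obtain ⟨a, ha, b, hb, hab⟩ := hΓ.cutConnected_univ (Γ.componentIn X z) (Set.subset_univ _)
      ⟨z, mem_componentIn_self⟩ ⟨w, trivial, fun h => hw (hsub h)⟩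
    have haF : a ∈ F :=
      ⟨(a, b), ⟨hsub ha, fun h => hb.2 (componentIn_closed ha hab h), hab⟩, rfl⟩
    exact Set.mem_biUnion haF (mem_componentIn_symm hz ha)
  have : ∃ a ∈ F, (Γ.componentIn X a).Infinite := by
    by_contra! hcon
    exact hX (((hb.image _).biUnion fun a ha => hcon a ha).subset hcov)
  obtain ⟨a, ha, hinf⟩ := this
  refine ⟨_, componentIn_subset (hFX ha), hinf, cutConnected_componentIn, hb.subset ?_,
    fun c hc d hd hcd => componentIn_closed hc hcd hd⟩
  rintro ⟨c, d⟩ ⟨hc, hd, hcd⟩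
  exact ⟨componentIn_subset (hFX ha) hc, fun h => hd (componentIn_closed hc hcd h), hcd⟩

end Boundary

/-! ### Tours of finite connected sets -/

/-- Removing from a connected set `C` a component of the complement of a connected subset `B`
leaves a connected set. -/
theorem CutConnected.diff_component {C B C' : Set V} (hC : Γ.CutConnected C)
    (hB : Γ.CutConnected B) (hBC : B ⊆ C) (hBne : B.Nonempty) (hC' : C' ⊆ C \ B)
    (hclosed : ∀ a ∈ C', ∀ b ∈ C \ B, Γ.Adj a b → b ∈ C') : Γ.CutConnected (C \ C') := by
  obtain ⟨s, hs⟩ := hBne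
  refine cutConnected_of_base s (fun X hX hsX hne => ?_) ⟨hBC hs, fun h => (hC' h).2 hs⟩
  by_cases hBX : B ⊆ X
  · obtain ⟨z, hz, hzX⟩ := hne
    obtain ⟨a, ha, b, hb, hab⟩ := hC ((C \ C') \ X) (fun a ha => ha.1.1) ⟨z, hz, hzX⟩
      ⟨s, hBC hs, fun h => h.2 hsX⟩
    -- The edge cannot end in `C'`: its other end `a` lies outside `B`, so closedness would put `a`
    -- into `C'`.
    by_cases hbC' : b ∈ C'
    · exact absurd (hclosed b hbC' a ⟨ha.1.1, fun h => ha.2 (hBX h)⟩ hab.symm) ha.1.2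
    · exact ⟨b, by by_contra h; exact hb.2 ⟨⟨hb.1, hbC'⟩, h⟩, a, ha, hab.symm⟩
  · obtain ⟨z, hz, hzX⟩ := Set.not_subset.mp hBX
    obtain ⟨a, ha, b, hb, hab⟩ := hB (X ∩ B) Set.inter_subset_right ⟨s, hsX, hs⟩
      ⟨z, hz, fun h => hzX h.1⟩
    exact ⟨a, ha.1, b, ⟨⟨hBC hb.1, fun h => (hC' h).2 hb.1⟩, fun h => hb.2 ⟨h, hb.1⟩⟩, hab⟩

/-- A connected set splits into two connected parts, one containing `x`, the other containing
`y` and meeting the neighbourhood of `x`. -/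
theorem CutConnected.exists_split {S : Set V} (hS : Γ.CutConnected S) {x y : V} (hx : x ∈ S)
    (hy : y ∈ S) (hxy : x ≠ y) :
    ∃ D ⊆ S, Γ.CutConnected D ∧ Γ.CutConnected (S \ D) ∧ y ∈ D ∧ x ∉ D ∧ ∃ u ∈ D, Γ.Adj x u := by
  have hsub : Γ.componentIn (S \ {x}) y ⊆ S \ {x} := componentIn_subset ⟨hy, hxy.symm⟩
  have hxD : x ∉ Γ.componentIn (S \ {x}) y := fun h => (hsub h).2 rfl
  refine ⟨Γ.componentIn (S \ {x}) y, hsub.trans Set.sdiff_subset, cutConnected_componentIn,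
    hS.diff_component (cutConnected_singleton x) (by simpa using hx) ⟨x, rfl⟩ hsub
      (fun a ha b hb hab => componentIn_closed ha hab hb), mem_componentIn_self, hxD, ?_⟩
  obtain ⟨a, ha, b, hb, hab⟩ := hS _ (hsub.trans Set.sdiff_subset) ⟨y, mem_componentIn_self⟩
    ⟨x, hx, hxD⟩
  by_cases hbx : b = x
  · exact ⟨a, ha, hbx ▸ hab.symm⟩
  · exact absurd (componentIn_closed ha hab ⟨hb.1, hbx⟩) hb.2

/-- The vertices of a finite connected set can be listed without repetition by jumps of length at
most three, from a given vertex `x` to a vertex at distance at most one from a given vertex `y`. -/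
theorem CutConnected.exists_list (hΓ : Γ.Connected) {S : Set V} (hfin : S.Finite)
    (hS : Γ.CutConnected S) {x y : V} (hx : x ∈ S) (hy : y ∈ S) :
    ∃ l : List V, l.Nodup ∧ (∀ v, v ∈ l ↔ v ∈ S) ∧ l.IsChain (fun a b => Γ.dist a b ≤ 3) ∧
      l.head? = some x ∧ ∃ z, l.getLast? = some z ∧ Γ.dist z y ≤ 1 := by
  induction hn : S.ncard using Nat.strong_induction_on generalizing S x y with
  | _ n ih =>
  subst hn
  have glue : ∀ D ⊆ S, x ∉ D → ∀ l₁ l₂ : List V, ∀ z₁ u z : V,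
      l₁.Nodup → (∀ v, v ∈ l₁ ↔ v ∈ S \ D) → l₁.IsChain (fun a b => Γ.dist a b ≤ 3) →
      l₁.head? = some x → l₁.getLast? = some z₁ →
      l₂.Nodup → (∀ v, v ∈ l₂ ↔ v ∈ D) → l₂.IsChain (fun a b => Γ.dist a b ≤ 3) →
      l₂.head? = some u → l₂.getLast? = some z → Γ.dist z₁ u ≤ 3 →
      (l₁ ++ l₂).Nodup ∧ (∀ v, v ∈ l₁ ++ l₂ ↔ v ∈ S) ∧
        (l₁ ++ l₂).IsChain (fun a b => Γ.dist a b ≤ 3) ∧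
        (l₁ ++ l₂).head? = some x ∧ (l₁ ++ l₂).getLast? = some z := by
    intro D hDS hxD l₁ l₂ z₁ u z n₁ m₁ c₁ f₁ e₁ n₂ m₂ c₂ f₂ e₂ hd
    refine ⟨?_, ?_, ?_, ?_, ?_⟩
    · rw [List.nodup_append']
      exact ⟨n₁, n₂, fun v hv hv' => ((m₁ v).mp hv).2 ((m₂ v).mp hv')⟩
    · intro v
      rw [List.mem_append, m₁, m₂]
      exact ⟨fun h => h.elim (fun h => h.1) (fun h => hDS h),
        fun h => (em (v ∈ D)).elim Or.inr fun h' => Or.inl ⟨h, h'⟩⟩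
    · rw [List.isChain_append]
      refine ⟨c₁, c₂, ?_⟩
      simp only [e₁, f₂, Option.mem_some_iff]
      rintro _ rfl _ rfl
      exact hd
    · simp [List.head?_append, f₁]
    · simp [List.getLast?_append, e₂]
  have hcard : ∀ D ⊆ S, ∀ w ∈ S, w ∉ D → D.ncard < S.ncard := fun D hD w hw hwD =>
    Set.ncard_lt_ncard ⟨hD, fun h => hwD (h hw)⟩ hfin
  by_cases hxy : x = y
  · subst hxy
    by_cases hsing : S ⊆ {x}
    · have : S = {x} := Set.Subset.antisymm hsing (by simpa using hx)
      subst this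
      exact ⟨[x], by simp, by simp, by simp, by simp, x, by simp, by simp⟩
    obtain ⟨w, hw, hwx⟩ := Set.not_subset.mp hsing
    -- For a round trip, tour `S \ D` from `x` back to near `x`, then tour `D` from near `u` to `u`,
    -- in reverse. The two tours meet along `z₁`, `x`, `u`, `z₂`, which is where the constant three
    -- comes from.
    obtain ⟨D, hDS, hD, hE, hwD, hxD, u, hu, hxu⟩ := hS.exists_split hx hw (Ne.symm hwx)
    obtain ⟨l₁, n₁, m₁, c₁, f₁, z₁, e₁, d₁⟩ := ih _ (hcard _ Set.sdiff_subset w hw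
      (fun h => h.2 hwD)) (hfin.sdiff) hE ⟨hx, hxD⟩ ⟨hx, hxD⟩ rfl
    obtain ⟨l₂, n₂, m₂, c₂, f₂, z₂, e₂, d₂⟩ := ih _ (hcard _ hDS x hx hxD) (hfin.subset hDS) hD
      hu hu rfl
    have hd : Γ.dist z₁ z₂ ≤ 3 := by
      have h1 := hΓ.dist_triangle (u := z₁) (v := x) (w := z₂)
      have h2 := hΓ.dist_triangle (u := x) (v := u) (w := z₂)
      rw [dist_eq_one_iff_adj.mpr hxu] at h2
      rw [dist_comm] at d₂
      omega
    obtain ⟨h1, h2, h3, h4, h5⟩ := glue D hDS hxD l₁ l₂.reverse z₁ z₂ u n₁ m₁ c₁ f₁ e₁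
      (List.nodup_reverse.mpr n₂) (by simpa using m₂)
      (by rw [List.isChain_reverse]; exact c₂.imp fun a b h => by rwa [dist_comm])
      (by simpa using e₂) (by simpa using f₂) hd
    exact ⟨_, h1, h2, h3, h4, u, h5, by rw [dist_eq_one_iff_adj.mpr hxu.symm]⟩
  -- Make a round trip at `x` through `S \ D`, then go from the neighbour `u` of `x` through `D` to
  -- near `y`.
  · obtain ⟨D, hDS, hD, hE, hyD, hxD, u, hu, hxu⟩ := hS.exists_split hx hy hxy
    obtain ⟨l₁, n₁, m₁, c₁, f₁, z₁, e₁, d₁⟩ := ih _ (hcard _ Set.sdiff_subset y hy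
      (fun h => h.2 hyD)) (hfin.sdiff) hE ⟨hx, hxD⟩ ⟨hx, hxD⟩ rfl
    obtain ⟨l₂, n₂, m₂, c₂, f₂, z₂, e₂, d₂⟩ := ih _ (hcard _ hDS x hx hxD) (hfin.subset hDS) hD
      hu hyD rfl
    have hd : Γ.dist z₁ u ≤ 3 := by
      have h1 := hΓ.dist_triangle (u := z₁) (v := x) (w := u)
      rw [dist_eq_one_iff_adj.mpr hxu] at h1
      omega
    obtain ⟨h1, h2, h3, h4, h5⟩ := glue D hDS hxD l₁ l₂ z₁ u z₂ n₁ m₁ c₁ f₁ e₁ n₂ m₂ c₂ f₂ e₂ hd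
    exact ⟨_, h1, h2, h3, h4, z₂, h5, d₂⟩

/-! ### One-sided sequences through one-ended sets -/

/-- A connected, locally finite graph has countably many vertices. -/
theorem Connected.countable_of_locallyFinite (hΓ : Γ.Connected)
    (hfin : ∀ v, (Γ.neighborSet v).Finite) : Countable V := by
  obtain ⟨x⟩ := hΓ.nonempty
  let F : ℕ → Set V := fun n => Nat.rec {x} (fun _ S => ⋃ a ∈ S, Γ.neighborSet a) n
  have hF : ∀ n, (F n).Finite := by
    intro n
    induction n with
    | zero => exact Set.finite_singleton x
    | succ n ih => exact ih.biUnion fun a _ => hfin a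
  have : ∀ z ∈ Set.univ, z ∈ ⋃ n, F n := by
    refine hΓ.cutConnected_univ.forall_mem (s := x) trivial (Set.mem_iUnion.mpr ⟨0, rfl⟩) ?_
    intro a _ b _ ha hab
    obtain ⟨n, hn⟩ := Set.mem_iUnion.mp ha
    exact Set.mem_iUnion.mpr ⟨n + 1, Set.mem_biUnion hn hab⟩
  rw [← Set.countable_univ_iff]
  exact (Set.countable_iUnion fun n => (hF n).countable).mono this

/-- An infinite connected set with finite boundary which cannot be divided into two infinite parts
with finite boundaries. -/
structure IsOneEndedSet (Γ : SimpleGraph V) (C : Set V) : Prop where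
  infinite : C.Infinite
  connected : Γ.CutConnected C
  finiteBoundary : Γ.FiniteBoundary C
  finite_or_finite : ∀ X ⊆ C, Γ.FiniteBoundary X → X.Finite ∨ (C \ X).Finite

/-- In a one-ended set, every cofinite connected subset `C` contains a finite connected set
through two given vertices whose removal leaves `C` connected. -/
theorem IsOneEndedSet.exists_piece {C₀ : Set V} (h : Γ.IsOneEndedSet C₀) (hΓ : Γ.Connected)
    (hfin : ∀ v, (Γ.neighborSet v).Finite) {C : Set V} (hC : C ⊆ C₀) (hcof : (C₀ \ C).Finite)
    (hcon : Γ.CutConnected C) {x v : V} (hx : x ∈ C) (hv : v ∈ C) :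
    ∃ T ⊆ C, T.Finite ∧ x ∈ T ∧ v ∈ T ∧ Γ.CutConnected T ∧ Γ.CutConnected (C \ T) := by
  obtain ⟨B, hBC, hBfin, hB, hxB, hvB⟩ := hcon.exists_finite_subset hx hv
  have hCinf : C.Infinite := fun hf => h.infinite <| (hf.union hcof).subset fun a ha => by
    by_cases haC : a ∈ C
    · exact Or.inl haC
    · exact Or.inr ⟨ha, haC⟩
  have hCb : Γ.FiniteBoundary C := by
    rw [← Set.sdiff_sdiff_cancel_left hC]
    exact h.finiteBoundary.diff (finiteBoundary_of_finite hfin hcof)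
  -- The piece is all of `C` outside an infinite component `C'` of `C \ B`; one-endedness makes it
  -- finite.
  obtain ⟨C', hsub, hinf, hcon', hb', hcl⟩ := hΓ.exists_infinite_component
    (hCinf.sdiff hBfin) (hCb.diff (finiteBoundary_of_finite hfin hBfin))
  have hC'C : C' ⊆ C := hsub.trans Set.sdiff_subset
  have hT : (C₀ \ C').Finite :=
    (h.finite_or_finite C' (hC'C.trans hC) hb').resolve_left hinf
  refine ⟨C \ C', Set.sdiff_subset, hT.subset (Set.sdiff_subset_sdiff_left hC),
    ⟨hx, fun h => (hsub h).2 hxB⟩,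
    ⟨hv, fun h => (hsub h).2 hvB⟩, hcon.diff_component hB hBC ⟨x, hxB⟩ hsub hcl, ?_⟩
  rwa [Set.sdiff_sdiff_cancel_left hC'C]

/-- A sequence of lists, each a proper prefix of the next, converges to an infinite sequence. -/
theorem exists_seq_of_lists {α : Type*} {R : α → α → Prop} (L : ℕ → List α)
    (hpre : ∀ n, L n <+: L (n + 1)) (hlen : ∀ n, (L n).length < (L (n + 1)).length)
    (hnodup : ∀ n, (L n).Nodup) (hchain : ∀ n, (L n).IsChain R) :
    ∃ P : ℕ → α, Function.Injective P ∧ (∀ a, a ∈ Set.range P ↔ ∃ n, a ∈ L n) ∧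
      ∀ n, R (P n) (P (n + 1)) := by
  have hlt : ∀ n, n < (L (n + 1)).length := by
    intro n
    induction n with
    | zero => exact Nat.zero_lt_of_lt (hlen 0)
    | succ n ih => exact Nat.lt_of_le_of_lt ih (hlen _)
  have hmono : ∀ m n, m ≤ n → L m <+: L n := by
    intro m n hmn
    induction hmn with
    | refl => exact List.prefix_rfl
    | step _ ih => exact ih.trans (hpre _)
  -- Entries never change once present, and the list of index `i + 1` is long enough to have an
  -- entry at position `i`.
  have hget : ∀ m i (hi : i < (L m).length), (L m)[i] = (L (i + 1))[i]'(hlt i) := by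
    intro m i hi
    rcases le_total m (i + 1) with hm | hm
    · exact (hmono _ _ hm).getElem hi
    · exact ((hmono _ _ hm).getElem (hlt i)).symm
  refine ⟨fun n => (L (n + 1))[n]'(hlt n), ?_, ?_, ?_⟩
  · intro i j hij
    have hi : i < (L (i + j + 1)).length := (hlt i).trans_le (hmono _ _ (by omega)).length_le
    have hj : j < (L (i + j + 1)).length := (hlt j).trans_le (hmono _ _ (by omega)).length_le
    simp only [← hget _ _ hi, ← hget _ _ hj] at hij
    exact (hnodup _).getElem_inj_iff.mp hij
  · intro a
    constructor
    · rintro ⟨n, rfl⟩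
      exact ⟨n + 1, List.getElem_mem _⟩
    · rintro ⟨n, hn⟩
      obtain ⟨i, hi, rfl⟩ := List.getElem_of_mem hn
      exact ⟨i, (hget n i hi).symm⟩
  · intro n
    have h := List.isChain_iff_getElem.mp (hchain (n + 2)) n (hlt (n + 1))
    rwa [hget (n + 2) n] at h

/-- The vertices of a one-ended set can be arranged in a one-sided infinite sequence with jumps of
length at most three. -/
theorem IsOneEndedSet.exists_seq {C₀ : Set V} (h : Γ.IsOneEndedSet C₀) (hΓ : Γ.Connected)
    (hfin : ∀ v, (Γ.neighborSet v).Finite) :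
    ∃ P : ℕ → V, Function.Injective P ∧ Set.range P = C₀ ∧ ∀ n, Γ.dist (P n) (P (n + 1)) ≤ 3 := by
  -- The last condition keeps a starting point for the next tour: a tour ends within one of a chosen
  -- `y`, and `y` is adjacent to an unlisted vertex, hence the bound two.
  let Good : List V → Prop := fun l => l.Nodup ∧ l.IsChain (fun a b => Γ.dist a b ≤ 3) ∧
    (∀ a ∈ l, a ∈ C₀) ∧ Γ.CutConnected (C₀ \ {a | a ∈ l}) ∧
    ∃ x ∈ C₀ \ {a | a ∈ l}, ∀ z ∈ l.getLast?, Γ.dist z x ≤ 2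
  have hinf : ∀ l : List V, (C₀ \ {a | a ∈ l}).Infinite := fun l =>
    h.infinite.sdiff (List.finite_toSet l)
  have hnil : Good [] := by
    obtain ⟨x, hx⟩ := h.infinite.nonempty
    exact ⟨by simp, by simp, by simp, by simpa using h.connected, x, by simpa using hx, by simp⟩
  have step : ∀ l : List V, ∀ v : V, Good l →
      ∃ l', Good l' ∧ l <+: l' ∧ l.length < l'.length ∧ (v ∈ C₀ → v ∈ l') := by
    rintro l v ⟨hnd, hch, hsub, hcon, x, hx, hlast⟩
    set C := C₀ \ {a | a ∈ l} with hCdef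
    have hcof : (C₀ \ C).Finite := (List.finite_toSet l).subset fun a ha => by
      by_contra hal
      exact ha.2 ⟨ha.1, hal⟩
    -- The next piece must absorb `v` if it is still unlisted; otherwise `x` serves as a dummy
    -- target.
    obtain ⟨w, hwC, hvw⟩ : ∃ w ∈ C, v ∈ C → w = v := by
      by_cases hv : v ∈ C
      · exact ⟨v, hv, fun _ => rfl⟩
      · exact ⟨x, hx, fun h => absurd h hv⟩
    obtain ⟨T, hTC, hTfin, hxT, hwT, hTcon, hcon'⟩ :=
      h.exists_piece hΓ hfin Set.sdiff_subset hcof hcon hx hwC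
    obtain ⟨q, hqC, hqT⟩ := ((hinf l).sdiff hTfin).nonempty
    obtain ⟨y, hy, x', hx', hyx'⟩ := hcon T hTC ⟨x, hxT⟩ ⟨q, hqC, hqT⟩
    obtain ⟨t, tnd, tm, tch, thead, z, tlast, hz⟩ :=
      CutConnected.exists_list hΓ hTfin hTcon hxT hy
    have hdiff : C₀ \ {a | a ∈ l ++ t} = C \ T := by
      ext a
      simp only [List.mem_append, Set.mem_sdiff, Set.mem_ofPred_eq, tm, hCdef]
      tauto
    have hne : t ≠ [] := by rintro rfl; simp at thead
    refine ⟨l ++ t, ⟨?_, ?_, ?_, ?_, x', ?_, ?_⟩, List.prefix_append _ _, ?_, ?_⟩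
    · rw [List.nodup_append']
      exact ⟨hnd, tnd, fun a ha hat => (hTC ((tm a).mp hat)).2 ha⟩
    · rw [List.isChain_append]
      refine ⟨hch, tch, fun a ha b hb => ?_⟩
      rw [thead, Option.mem_some_iff] at hb
      subst hb
      exact (hlast a ha).trans (by norm_num)
    · intro a ha
      rcases List.mem_append.mp ha with ha | ha
      · exact hsub a ha
      · exact (hTC ((tm a).mp ha)).1
    · rwa [hdiff]
    · rwa [hdiff]
    · intro a ha
      have : a = z := by simpa [List.getLast?_append, tlast, eq_comm] using ha
      subst this
      have h1 := hΓ.dist_triangle (u := a) (v := y) (w := x')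
      rw [dist_eq_one_iff_adj.mpr hyx'] at h1
      omega
    · rw [List.length_append]
      have := List.length_pos_iff.mpr hne
      omega
    · intro hv
      by_cases hvl : v ∈ l
      · exact List.mem_append_left _ hvl
      · exact List.mem_append_right _ ((tm v).mpr (hvw ⟨hv, hvl⟩ ▸ hwT))
  choose next hgood hpre hlen hmem using step
  have := hΓ.countable_of_locallyFinite hfin
  have := hΓ.nonempty
  obtain ⟨e, he⟩ := exists_surjective_nat V
  let S : ℕ → {l // Good l} := fun n =>
    Nat.rec ⟨[], hnil⟩ (fun n l => ⟨next l.1 (e n) l.2, hgood _ _ _⟩) n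
  obtain ⟨P, hinj, hrange, hP⟩ := exists_seq_of_lists (fun n => (S n).1)
    (fun n => hpre (S n).1 (e n) (S n).2) (fun n => hlen (S n).1 (e n) (S n).2)
    (fun n => (S n).2.1) (fun n => (S n).2.2.1)
  refine ⟨P, hinj, Set.ext fun a => (hrange a).trans ⟨?_, fun ha => ?_⟩, hP⟩
  · rintro ⟨n, hn⟩
    exact (S n).2.2.2.1 a hn
  · obtain ⟨n, rfl⟩ := he a
    exact ⟨n + 1, hmem (S n).1 (e n) (S n).2 ha⟩

/-! ### Bi-infinite sequences -/

/-- Finitely many vertices can be added to a sequence with bounded jumps. -/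
theorem exists_seq_union {P : ℕ → V} (hinj : Function.Injective P) {K : ℕ}
    (hP : ∀ n, Γ.dist (P n) (P (n + 1)) ≤ K) {F : Set V} (hF : F.Finite)
    (hdisj : Disjoint F (Set.range P)) :
    ∃ Q : ℕ → V, Function.Injective Q ∧ Set.range Q = F ∪ Set.range P ∧
      ∃ L, ∀ n, Γ.dist (Q n) (Q (n + 1)) ≤ L := by
  induction F, hF using Set.Finite.induction_on with
  | empty => exact ⟨P, hinj, by simp, K, hP⟩
  | @insert a F haF _ ih =>
    obtain ⟨Q, hQ, hrange, L, hL⟩ := ih (hdisj.mono_left (Set.subset_insert _ _))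
    have haQ : a ∉ Set.range Q := by
      rw [hrange]
      rintro (h | h)
      · exact haF h
      · exact Set.disjoint_left.mp hdisj (Set.mem_insert _ _) h
    refine ⟨fun n => Nat.casesOn n a Q, ?_, ?_, max L (Γ.dist a (Q 0)), ?_⟩
    · rintro (_ | m) (_ | n) hmn
      · rfl
      · exact absurd ⟨n, hmn.symm⟩ haQ
      · exact absurd ⟨m, hmn⟩ haQ
      · exact congrArg _ (hQ hmn)
    · rw [Set.insert_union, ← hrange]
      ext v
      constructor
      · rintro ⟨_ | n, rfl⟩
        · exact Or.inl rfl
        · exact Or.inr ⟨n, rfl⟩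
      · rintro (rfl | ⟨n, rfl⟩)
        · exact ⟨0, rfl⟩
        · exact ⟨n + 1, rfl⟩
    · rintro (_ | n)
      · exact le_max_right _ _
      · exact (hL n).trans (le_max_left _ _)

/-- Two sequences with bounded jumps which together visit every vertex once form a bi-infinite
sequence with bounded jumps. -/
theorem exists_int_seq_of_nat_seqs {P Q : ℕ → V} (hP : Function.Injective P)
    (hQ : Function.Injective Q) (hcompl : IsCompl (Set.range P) (Set.range Q)) {K L : ℕ}
    (hK : ∀ n, Γ.dist (P n) (P (n + 1)) ≤ K) (hL : ∀ n, Γ.dist (Q n) (Q (n + 1)) ≤ L) :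
    ∃ R : ℤ → V, Function.Bijective R ∧ ∃ M, ∀ i, Γ.dist (R i) (R (i + 1)) ≤ M := by
  have hne : ∀ m n, P m ≠ Q n := fun m n h =>
    Set.disjoint_left.mp hcompl.disjoint ⟨m, rfl⟩ ⟨n, h.symm⟩
  -- `Q` runs backwards along the negative integers, so the only new jump is from `Q 0` at `-1` to
  -- `P 0` at `0`.
  refine ⟨fun i => Int.casesOn i P Q, ⟨?_, ?_⟩, max (max K L) (Γ.dist (Q 0) (P 0)), ?_⟩
  · rintro (m | m) (n | n) hmn
    · exact congrArg _ (hP hmn)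
    · exact absurd hmn (hne m n)
    · exact absurd hmn.symm (hne n m)
    · exact congrArg _ (hQ hmn)
  · intro v
    have : v ∈ Set.range P ∪ Set.range Q :=
      (show Set.range P ∪ Set.range Q = Set.univ from hcompl.sup_eq_top) ▸ Set.mem_univ v
    rcases this with ⟨n, rfl⟩ | ⟨n, rfl⟩
    · exact ⟨Int.ofNat n, rfl⟩
    · exact ⟨Int.negSucc n, rfl⟩
  · rintro (n | _ | n)
    · exact (hK n).trans ((le_max_left _ _).trans (le_max_left _ _))
    · exact le_max_right _ _
    · have : Int.negSucc (n + 1) + 1 = Int.negSucc n := by omega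
      rw [this, dist_comm]
      exact (hL n).trans ((le_max_right _ _).trans (le_max_left _ _))

/-- If the vertices of a graph do not contain three disjoint infinite sets with finite boundaries,
then they form a bi-infinite sequence with bounded jumps. -/
theorem Connected.exists_int_seq (hΓ : Γ.Connected) (hfin : ∀ v, (Γ.neighborSet v).Finite)
    [Infinite V]
    (h3 : ∀ X Y Z : Set V, Γ.FiniteBoundary X → Γ.FiniteBoundary Y → Γ.FiniteBoundary Z →
      X.Infinite → Y.Infinite → Z.Infinite → Disjoint X Y → Disjoint X Z → Disjoint Y Z → False) :
    ∃ R : ℤ → V, Function.Bijective R ∧ ∃ M, ∀ i, Γ.dist (R i) (R (i + 1)) ≤ M := by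
  by_cases hone : ∀ X, Γ.FiniteBoundary X → X.Finite ∨ Xᶜ.Finite
  · have huniv : Γ.IsOneEndedSet Set.univ := ⟨Set.infinite_univ, hΓ.cutConnected_univ,
      finiteBoundary_univ, fun X _ hX => by
        rw [← Set.compl_eq_univ_sdiff]; exact hone X hX⟩
    obtain ⟨P, hinj, hrange, hP⟩ := huniv.exists_seq hΓ hfin
    have hP2 : ∀ n, Γ.dist (P n) (P (n + 2)) ≤ 6 := fun n => by
      have := hΓ.dist_triangle (u := P n) (v := P (n + 1)) (w := P (n + 2))
      have h1 := hP n
      have h2 : Γ.dist (P (n + 1)) (P (n + 2)) ≤ 3 := hP (n + 1)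
      omega
    -- Even terms form one ray and odd terms the other; each jump skips one term, so its length is
    -- at most six.
    refine exists_int_seq_of_nat_seqs (P := fun n => P (2 * n)) (Q := fun n => P (2 * n + 1))
      (fun m n h => by have := hinj h; omega) (fun m n h => by have := hinj h; omega) ?_
      (K := 6) (L := 6) (fun n => hP2 (2 * n)) (fun n => hP2 (2 * n + 1))
    refine IsCompl.of_eq ?_ ?_
    · refine Set.eq_empty_iff_forall_notMem.mpr ?_
      rintro _ ⟨⟨m, rfl⟩, ⟨n, hn⟩⟩
      have := hinj hn
      omega
    · refine Set.eq_univ_of_forall fun v => ?_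
      obtain ⟨n, rfl⟩ : v ∈ Set.range P := hrange ▸ trivial
      rcases Nat.even_or_odd' n with ⟨k, rfl | rfl⟩
      · exact Or.inl ⟨k, rfl⟩
      · exact Or.inr ⟨k, rfl⟩
  · push Not at hone
    obtain ⟨X, hXb, hX, hX'⟩ := hone
    -- Any further division of `X` into two infinite parts, together with `Xᶜ`, would violate `h3`.
    have key : ∀ X : Set V, Γ.FiniteBoundary X → X.Infinite → Xᶜ.Infinite →
        ∃ C ⊆ X, Γ.IsOneEndedSet C ∧ (X \ C).Finite := by
      intro X hXb hX hX'
      obtain ⟨C, hCX, hC, hcon, hCb, -⟩ := hΓ.exists_infinite_component hX hXb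
      refine ⟨C, hCX, ⟨hC, hcon, hCb, fun Y hY hYb => ?_⟩, ?_⟩
      · by_contra! hcon
        exact h3 Y (C \ Y) Xᶜ hYb (hCb.diff hYb) hXb.compl hcon.1 hcon.2 hX'
          Set.disjoint_sdiff_right (Set.disjoint_compl_right_iff_subset.mpr (hY.trans hCX))
          (Set.disjoint_compl_right_iff_subset.mpr (Set.sdiff_subset.trans hCX))
      · by_contra hinf
        exact h3 C (X \ C) Xᶜ hCb (hXb.diff hCb) hXb.compl hC hinf hX'
          Set.disjoint_sdiff_right (Set.disjoint_compl_right_iff_subset.mpr hCX)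
          (Set.disjoint_compl_right_iff_subset.mpr Set.sdiff_subset)
    obtain ⟨C, hCX, hC, hCf⟩ := key X hXb hX hX'
    obtain ⟨D, hDX, hD, hDf⟩ := key Xᶜ hXb.compl hX' (by rwa [compl_compl])
    obtain ⟨P, hPinj, hPr, hP⟩ := hC.exists_seq hΓ hfin
    obtain ⟨Q, hQinj, hQr, hQ⟩ := hD.exists_seq hΓ hfin
    obtain ⟨P', hP'inj, hP'r, K, hP'⟩ := exists_seq_union hPinj hP hCf
      (hPr ▸ Set.disjoint_sdiff_left)
    obtain ⟨Q', hQ'inj, hQ'r, L, hQ'⟩ := exists_seq_union hQinj hQ hDf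
      (hQr ▸ Set.disjoint_sdiff_left)
    refine exists_int_seq_of_nat_seqs hP'inj hQ'inj ?_ hP' hQ'
    rw [hP'r, hQ'r, hPr, hQr, Set.sdiff_union_of_subset hCX, Set.sdiff_union_of_subset hDX]
    exact isCompl_compl

/-! ### Ends and bounded-jump listings -/

/-- Three disjoint infinite connected sets with finite boundaries force three ends. -/
theorem two_lt_numEnds {C : Fin 3 → Set V} (hcon : ∀ i, Γ.CutConnected (C i))
    (hb : ∀ i, Γ.FiniteBoundary (C i)) (hinf : ∀ i, (C i).Infinite)
    (hdisj : Pairwise fun i j => Disjoint (C i) (C j)) : 2 < Γ.numEnds := by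
  set B : Set (V × V) := ⋃ i, {p : V × V | p.1 ∈ C i ∧ p.2 ∉ C i ∧ Γ.Adj p.1 p.2} with hB
  set A : Set (Sym2 V) := (fun p : V × V => s(p.1, p.2)) '' B with hA
  have hAfin : A.Finite := (Set.finite_iUnion hb).image _
  have hAsub : A ⊆ Γ.edgeSet := by
    rintro _ ⟨p, hp, rfl⟩
    obtain ⟨i, hi⟩ := Set.mem_iUnion.mp hp
    exact hi.2.2
  choose c hc using fun i => (hinf i).nonempty
  -- Every deleted edge leaves some `C j`. By disjointness none has both endpoints in one `C i`, so
  -- each `C i` stays connected.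
  have hreach : ∀ i, ∀ z ∈ C i, (Γ.deleteEdges A).Reachable (c i) z := by
    intro i
    refine (hcon i).forall_mem (hc i) (Reachable.refl _) fun a ha b hb' h hab => ?_
    refine h.trans (Adj.reachable (deleteEdges_adj.mpr ⟨hab, ?_⟩))
    rintro ⟨⟨p, q⟩, hp, hpq⟩
    obtain ⟨j, hj1, hj2, -⟩ := Set.mem_iUnion.mp hp
    have hij : i = j := by
      by_contra hne
      have := Set.disjoint_left.mp (hdisj hne)
      rcases Sym2.eq_iff.mp hpq with ⟨h1, h2⟩ | ⟨h1, h2⟩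
      · exact this ha (h1 ▸ hj1)
      · exact this hb' (h1 ▸ hj1)
    subst hij
    rcases Sym2.eq_iff.mp hpq with ⟨h1, h2⟩ | ⟨h1, h2⟩
    · exact hj2 (h2 ▸ hb')
    · exact hj2 (h2 ▸ ha)
  have hstay : ∀ i z, (Γ.deleteEdges A).Reachable (c i) z → z ∈ C i := by
    rintro i z ⟨w⟩
    by_contra hz
    obtain ⟨d, -, hd, hd'⟩ := w.exists_boundary_dart (C i) (hc i) hz
    have := deleteEdges_adj.mp d.adj
    exact this.2 ⟨(d.fst, d.snd), Set.mem_iUnion.mpr ⟨i, hd, hd', this.1⟩, rfl⟩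
  let K : Fin 3 → (Γ.deleteEdges A).ConnectedComponent := fun i =>
    (Γ.deleteEdges A).connectedComponentMk (c i)
  have hK : Function.Injective K := by
    intro i j hij
    by_contra hne
    exact Set.disjoint_left.mp (hdisj hne) (hstay i _ (ConnectedComponent.exact hij)) (hc j)
  have hKinf : ∀ i, (K i).supp.Infinite := fun i =>
    (hinf i).mono fun z hz => ConnectedComponent.sound (hreach i z hz).symm
  have hcard : (3 : ℕ∞) ≤ {C : (Γ.deleteEdges A).ConnectedComponent | C.supp.Infinite}.encard := by
    have h1 : (Set.range K).encard = 3 := by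
      rw [← Set.image_univ, hK.encard_image, Set.encard_univ]
      simp
    rw [← h1]
    exact Set.encard_le_encard (Set.range_subset_iff.mpr hKinf)
  have : (3 : ℕ∞) ≤ Γ.numEnds := hcard.trans
    (le_iSup₂_of_le A hAsub (le_iSup_of_le hAfin le_rfl))
  exact lt_of_lt_of_le (by norm_num) this

theorem Connected.not_three_disjoint (hΓ : Γ.Connected) (h : Γ.numEnds ≤ 2) (X Y Z : Set V)
    (hX : Γ.FiniteBoundary X) (hY : Γ.FiniteBoundary Y) (hZ : Γ.FiniteBoundary Z)
    (hX' : X.Infinite) (hY' : Y.Infinite) (hZ' : Z.Infinite)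
    (hXY : Disjoint X Y) (hXZ : Disjoint X Z) (hYZ : Disjoint Y Z) : False := by
  obtain ⟨C₁, h₁, i₁, c₁, b₁, -⟩ := hΓ.exists_infinite_component hX' hX
  obtain ⟨C₂, h₂, i₂, c₂, b₂, -⟩ := hΓ.exists_infinite_component hY' hY
  obtain ⟨C₃, h₃, i₃, c₃, b₃, -⟩ := hΓ.exists_infinite_component hZ' hZ
  refine (two_lt_numEnds (Γ := Γ) (C := ![C₁, C₂, C₃]) ?_ ?_ ?_ ?_).not_ge h
  · intro i; fin_cases i <;> assumption
  · intro i; fin_cases i <;> assumption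
  · intro i; fin_cases i <;> assumption
  · have d₁ := hXY.mono h₁ h₂
    have d₂ := hXZ.mono h₁ h₃
    have d₃ := hYZ.mono h₂ h₃
    intro i j hij
    fin_cases i <;> fin_cases j <;>
      first | exact absurd rfl hij | assumption | (apply Disjoint.symm; assumption)

theorem Connected.finite_setOf_dist_le (hΓ : Γ.Connected)
    (hfin : ∀ v, (Γ.neighborSet v).Finite) (a : V) (n : ℕ) : {v | Γ.dist v a ≤ n}.Finite := by
  have hw : ∀ n, {v | ∃ w : Γ.Walk v a, w.length = n}.Finite := by
    intro n
    induction n with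
    | zero =>
      refine (Set.finite_singleton a).subset ?_
      rintro v ⟨w, hw⟩
      exact Walk.eq_of_length_eq_zero hw
    | succ n ih =>
      refine (ih.biUnion fun u _ => hfin u).subset ?_
      rintro v ⟨_ | ⟨h, w⟩, hw⟩
      · simp at hw
      · exact Set.mem_biUnion ⟨w, by simpa using hw⟩ h.symm
  refine ((Set.finite_Iic n).biUnion fun k _ => hw k).subset fun v hv => ?_
  obtain ⟨w, hw⟩ := hΓ.exists_walk_length_eq_dist v a
  exact Set.mem_biUnion (Set.mem_Iic.mpr hv) ⟨w, hw⟩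

/-- A graph whose vertices are listed along an interval of integers with bounded jumps has at most
two ends. -/
theorem Connected.numEnds_le_two_of_seq (hΓ : Γ.Connected)
    (hfin : ∀ v, (Γ.neighborSet v).Finite) {I : Set ℤ} (hI : I.OrdConnected) {p : I → V}
    (hp : Function.Bijective p) {L : ℕ}
    (hL : ∀ i j : I, (j : ℤ) = i + 1 → Γ.dist (p i) (p j) ≤ L) : Γ.numEnds ≤ 2 := by
  refine iSup_le fun A => iSup_le fun _ => iSup_le fun hA => ?_
  set G := Γ.deleteEdges A with hG
  -- A shortest walk between consecutive terms has length at most `L`. If it uses a deleted edge,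
  -- its start is within `L` of an endpoint of that edge and so lies in `N`.
  let N : Set V := ⋃ e ∈ A, ⋃ a ∈ e, {v | Γ.dist v a ≤ L}
  have hN : N.Finite := hA.biUnion fun e _ => by
    refine Set.Finite.biUnion ?_ fun a _ => hΓ.finite_setOf_dist_le hfin a L
    induction e with
    | _ x y => exact ((Set.finite_singleton y).insert x).subset fun z hz => Sym2.mem_iff.mp hz
  have hstep : ∀ i j : I, (j : ℤ) = i + 1 → p i ∉ N → G.Reachable (p i) (p j) := by
    intro i j hij hi
    obtain ⟨w, hw⟩ := hΓ.exists_walk_length_eq_dist (p i) (p j)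
    refine ⟨w.toDeleteEdges A fun e he heA => hi ?_⟩
    induction e with
    | _ x y =>
      refine Set.mem_biUnion heA (Set.mem_biUnion (Sym2.mem_mk_left x y) ?_)
      classical
      have hx := w.fst_mem_support_of_mem_edges he
      exact (dist_le (w.takeUntil x hx)).trans
        ((w.length_takeUntil_le_length hx).trans (hw.le.trans (hL i j hij)))
  have hbad : (Subtype.val '' (p ⁻¹' N)).Finite := (hN.preimage hp.injective.injOn).image _
  obtain ⟨u, hu⟩ := hbad.bddAbove
  obtain ⟨l, hl⟩ := hbad.bddBelow
  have hright : ∀ i j : I, u < i → u < j → G.Reachable (p i) (p j) := by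
    have key : ∀ i : I, u < i → ∀ n : ℤ, (i : ℤ) ≤ n → ∀ hn : n ∈ I,
        G.Reachable (p i) (p ⟨n, hn⟩) := by
      intro i hi n hin
      induction n, hin using Int.leInduction with
      | base => exact fun _ => Reachable.refl _
      | succ n hin ih =>
        intro hn
        have hnI : n ∈ I := hI.out i.2 hn ⟨hin, by omega⟩
        refine (ih hnI).trans (hstep ⟨n, hnI⟩ ⟨n + 1, hn⟩ rfl fun h => ?_)
        have : n ≤ u := hu ⟨_, h, rfl⟩
        omega
    intro i j hi hj
    rcases le_total (i : ℤ) j with h | h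
    · exact key i hi j h j.2
    · exact (key j hj i h i.2).symm
  have hleft : ∀ i j : I, (i : ℤ) < l → (j : ℤ) < l → G.Reachable (p i) (p j) := by
    have key : ∀ i : I, ∀ n : ℤ, (i : ℤ) ≤ n → n < l → ∀ hn : n ∈ I,
        G.Reachable (p i) (p ⟨n, hn⟩) := by
      intro i n hin
      induction n, hin using Int.leInduction with
      | base => exact fun _ _ => Reachable.refl _
      | succ n hin ih =>
        intro hnl hn
        have hnI : n ∈ I := hI.out i.2 hn ⟨hin, by omega⟩
        refine (ih (by omega) hnI).trans (hstep ⟨n, hnI⟩ ⟨n + 1, hn⟩ rfl fun h => ?_)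
        have : l ≤ n := hl ⟨_, h, rfl⟩
        omega
    intro i j hi hj
    rcases le_total (i : ℤ) j with h | h
    · exact key i j h hj j.2
    · exact (key j i h hi i.2).symm
  have hside : ∀ K : G.ConnectedComponent, K.supp.Infinite →
      ∃ i : I, G.connectedComponentMk (p i) = K ∧ (u < i ∨ (i : ℤ) < l) := by
    intro K hK
    by_contra! hcon
    -- An infinite component occupies infinitely many indices, which do not all fit into the
    -- interval from `l` to `u`.
    have himg : (p ⁻¹' K.supp).Infinite := hK.preimage (by simp [hp.surjective.range_eq])
    refine himg.image Subtype.val_injective.injOn ((Set.finite_Icc l u).subset ?_)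
    rintro _ ⟨i, hi, rfl⟩
    exact (hcon i hi).symm
  by_contra! hcard
  obtain ⟨T, hTs, hT⟩ := Set.exists_subset_encard_eq (Order.add_one_le_of_lt hcard)
  obtain ⟨K₁, K₂, K₃, h12, h13, h23, rfl⟩ := Set.encard_eq_three.mp (hT.trans (by norm_num))
  obtain ⟨i₁, e₁, s₁⟩ := hside K₁ (hTs (by simp))
  obtain ⟨i₂, e₂, s₂⟩ := hside K₂ (hTs (by simp))
  obtain ⟨i₃, e₃, s₃⟩ := hside K₃ (hTs (by simp))
  -- Pigeonhole: three distinct components would have to share two tails, each lying in one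
  -- component.
  have hr : ∀ i j : I, G.connectedComponentMk (p i) ≠ G.connectedComponentMk (p j) →
      (u < i → ¬ u < j) ∧ ((i : ℤ) < l → ¬ (j : ℤ) < l) := fun i j hne =>
    ⟨fun h h' => hne (ConnectedComponent.sound (hright i j h h')),
      fun h h' => hne (ConnectedComponent.sound (hleft i j h h'))⟩
  have a := hr i₁ i₂ (by rwa [e₁, e₂])
  have b := hr i₁ i₃ (by rwa [e₁, e₃])
  have c := hr i₂ i₃ (by rwa [e₂, e₃])
  tauto

/-! ### Listings, Hamiltonian paths and integer actions -/

/-- A listing of the vertices with bounded jumps is a Hamiltonian path of a bilipschitz equivalent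
graph. -/
theorem Connected.exists_bilipschitzEquivalent_of_seq (hΓ : Γ.Connected) {I : Set ℤ}
    (hI : I.OrdConnected) {p : I → V} (hp : Function.Bijective p) {L : ℕ}
    (hL : ∀ i j : I, (j : ℤ) = i + 1 → Γ.dist (p i) (p j) ≤ L) :
    ∃ Δ : SimpleGraph V, Γ.BilipschitzEquivalent Δ ∧ Δ.IsHamiltonianPath I p := by
  -- The threshold is `L + 1` so that edges of `Γ` survive even for `L = 0`.
  let Δ : SimpleGraph V :=
    { Adj := fun x y => x ≠ y ∧ Γ.dist x y ≤ L + 1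
      symm := ⟨fun x y h => ⟨h.1.symm, by rw [dist_comm]; exact h.2⟩⟩
      loopless := ⟨fun x h => h.1 rfl⟩ }
  have hle : Γ ≤ Δ := fun x y h => ⟨h.ne, by rw [dist_eq_one_iff_adj.mpr h]; omega⟩
  have hΔ : Δ.Connected := hΓ.mono hle
  have hwalk : ∀ x y (w : Δ.Walk x y), Γ.dist x y ≤ (L + 1) * w.length := by
    intro x y w
    induction w with
    | nil => simp
    | @cons a b c h w ih =>
      have h1 := hΓ.dist_triangle (u := a) (v := b) (w := c)
      have h2 : Γ.dist a b ≤ L + 1 := h.2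
      rw [Walk.length_cons, mul_add]
      omega
  refine ⟨Δ, ⟨hΓ, hΔ, id, Function.bijective_id, L + 1, by positivity, fun x y => ⟨?_, ?_⟩⟩,
    hI, fun i j hij => ⟨fun h => ?_, (hL i j hij).trans (Nat.le_succ L)⟩,
    fun v => hp.existsUnique v⟩
  · obtain ⟨w, hw⟩ := hΓ.exists_walk_length_eq_dist x y
    have h : Δ.dist x y ≤ Γ.dist x y := by
      rw [← hw, ← Walk.length_mapLe hle w]
      exact dist_le _
    have h' : (Δ.dist x y : ℝ) ≤ Γ.dist x y := by exact_mod_cast h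
    have h'' : (0 : ℝ) ≤ L * Γ.dist x y := by positivity
    simp only [id]
    linarith
  · obtain ⟨w, hw⟩ := hΔ.exists_walk_length_eq_dist x y
    have h : (Γ.dist x y : ℝ) ≤ (L + 1) * Δ.dist x y := by
      rw [← hw]; exact_mod_cast hwalk x y w
    rw [one_div, inv_mul_le_iff₀ (by positivity)]
    exact h
  · have := congrArg Subtype.val (hp.injective h)
    omega

/-- Pull the path back along the bijection: the lower bilipschitz bound turns an edge of `Δ` into a
jump of length at most `c`. -/
theorem BilipschitzEquivalent.exists_seq {W : Type u} {Δ : SimpleGraph W}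
    (h : Γ.BilipschitzEquivalent Δ) {I : Set ℤ} {P : I → W} (hP : Δ.IsHamiltonianPath I P) :
    ∃ p : I → V, Function.Bijective p ∧
      ∃ L : ℕ, ∀ i j : I, (j : ℤ) = i + 1 → Γ.dist (p i) (p j) ≤ L := by
  obtain ⟨-, -, f, hf, c, hc, hbil⟩ := h
  let e := Equiv.ofBijective f hf
  refine ⟨e.symm ∘ P, e.symm.bijective.comp
    ((Function.bijective_iff_existsUnique P).mpr hP.visits_once), ⌈c⌉₊, fun i j hij => ?_⟩
  have h := (hbil (e.symm (P i)) (e.symm (P j))).2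
  have he : ∀ w, f (e.symm w) = w := e.apply_symm_apply
  rw [he, he, dist_eq_one_iff_adj.mpr (hP.adj i j hij), one_div, inv_mul_le_iff₀ hc,
    Nat.cast_one, mul_one] at h
  exact_mod_cast h.trans (Nat.le_ceil c)

/-- A transitive translation-like action of the integers amounts to a bi-infinite listing of the
vertices with bounded jumps. -/
theorem Connected.admitsTransitiveTranslationLikeIntAction_iff (hΓ : Γ.Connected) :
    Γ.AdmitsTransitiveTranslationLikeIntAction ↔
      ∃ R : ℤ → V, Function.Bijective R ∧ ∃ M, ∀ i, Γ.dist (R i) (R (i + 1)) ≤ M := by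
  constructor
  · rintro ⟨act, htl, htr⟩
    obtain ⟨x⟩ := hΓ.nonempty
    refine ⟨fun i => AddOpposite.op i +ᵥ x, ⟨fun i j hij => ?_, fun v => ?_⟩, ?_⟩
    · have h : AddOpposite.op (i - j) +ᵥ (AddOpposite.op j +ᵥ x) = AddOpposite.op j +ᵥ x := by
        rw [vadd_vadd, ← AddOpposite.op_add]
        simpa using hij
      have := htl.free _ _ h
      omega
    · obtain ⟨g, hg⟩ := htr.exists_vadd_eq x v
      exact ⟨g.unop, hg⟩
    · obtain ⟨M, hM⟩ := htl.bounded 1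
      refine ⟨M, fun i => ?_⟩
      have := hM ⟨AddOpposite.op i +ᵥ x, rfl⟩
      simpa only [vadd_vadd, ← AddOpposite.op_add] using this
  · rintro ⟨R, hR, M, hM⟩
    let e := Equiv.ofBijective R hR
    have he : ∀ v, R (e.symm v) = v := e.apply_symm_apply
    have hbound : ∀ (n : ℕ) (i : ℤ), Γ.dist (R i) (R (i + n)) ≤ n * M := by
      intro n i
      induction n with
      | zero => simp
      | succ n ih =>
        have h1 := hΓ.dist_triangle (u := R i) (v := R (i + n)) (w := R (i + n + 1))
        have h2 := hM (i + n)
        have h3 : i + ((n + 1 : ℕ) : ℤ) = i + n + 1 := by push_cast; ring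
        rw [h3, add_mul]
        omega
    let act : AddAction ℤᵃᵒᵖ V :=
      { vadd := fun g v => R (e.symm v + g.unop)
        zero_vadd := fun v => by
          change R (e.symm v + 0) = v
          rw [add_zero, he]
        add_vadd := fun g h v => by
          change R (e.symm v + (h.unop + g.unop)) = R (e.symm (R (e.symm v + h.unop)) + g.unop)
          rw [show R (e.symm v + h.unop) = e (e.symm v + h.unop) from rfl, e.symm_apply_apply,
            add_assoc] }
    refine ⟨act, ⟨fun x h hx => ?_, fun h => ⟨h.natAbs * M, ?_⟩⟩, ⟨fun x y => ?_⟩⟩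
    · have hx' : R (e.symm x + h) = R (e.symm x) := hx.trans (he x).symm
      have := hR.injective hx'
      omega
    · rintro _ ⟨x, rfl⟩
      change Γ.dist x (R (e.symm x + h)) ≤ _
      rcases Int.natAbs_eq h with hh | hh
      · have := hbound h.natAbs (e.symm x)
        rwa [he, ← hh] at this
      · have := hbound h.natAbs (e.symm x + h)
        rwa [show e.symm x + h + (h.natAbs : ℤ) = e.symm x by omega, he, dist_comm] at this
    · refine ⟨AddOpposite.op (e.symm y - e.symm x), ?_⟩
      change R (e.symm x + (e.symm y - e.symm x)) = y
      rw [add_sub_cancel, he]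

theorem UniformlyBoundedDegree.finite_neighborSet (h : Γ.UniformlyBoundedDegree) (v : V) :
    (Γ.neighborSet v).Finite := by
  obtain ⟨D, hD⟩ := h
  exact Set.finite_of_encard_le_coe (hD v)

/-- Any enumeration works, since the distances in a finite graph are bounded. -/
theorem Connected.exists_admitsHamiltonianPath_of_finite [Finite V] (hΓ : Γ.Connected) :
    ∃ Δ : SimpleGraph V, Γ.BilipschitzEquivalent Δ ∧ Δ.AdmitsHamiltonianPath := by
  obtain ⟨n, ⟨e⟩⟩ := Finite.exists_equiv_fin V
  let g : Set.Ico (0 : ℤ) n ≃ Fin n :=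
    { toFun := fun i => ⟨(i : ℤ).toNat, by have := i.2.1; have := i.2.2; omega⟩
      invFun := fun k => ⟨(k : ℕ), by simp⟩
      left_inv := fun i => Subtype.ext (by simpa using i.2.1)
      right_inv := fun k => by simp }
  obtain ⟨L, hL⟩ := (Set.finite_range fun q : V × V => Γ.dist q.1 q.2).bddAbove
  obtain ⟨Δ, hΔ, hham⟩ := hΓ.exists_bilipschitzEquivalent_of_seq Set.ordConnected_Ico
    (g.trans e.symm).bijective (L := L) fun i j _ => hL ⟨(_, _), rfl⟩
  exact ⟨Δ, hΔ, _, _, hham⟩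

end SimpleGraph

theorem mainTheorem4 {V : Type u} (Γ : SimpleGraph V) (hconn : Γ.Connected)
    (hdeg : Γ.UniformlyBoundedDegree) :
    ((∃ (W : Type u) (Δ : SimpleGraph W),
        Γ.BilipschitzEquivalent Δ ∧ Δ.AdmitsHamiltonianPath) ↔ Γ.numEnds ≤ 2) ∧
    (Infinite V →
      ((∃ (W : Type u) (Δ : SimpleGraph W),
          Γ.BilipschitzEquivalent Δ ∧ Δ.AdmitsBiinfiniteHamiltonianPath) ↔ Γ.numEnds ≤ 2) ∧
      (Γ.AdmitsTransitiveTranslationLikeIntAction ↔ Γ.numEnds ≤ 2)) := by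
  have hfin := hdeg.finite_neighborSet
  have hends : ∀ {W : Type u} {Δ : SimpleGraph W}, Γ.BilipschitzEquivalent Δ →
      Δ.AdmitsHamiltonianPath → Γ.numEnds ≤ 2 := by
    rintro W Δ hΔ ⟨I, P, hP⟩
    obtain ⟨p, hp, L, hL⟩ := hΔ.exists_seq hP
    exact hconn.numEnds_le_two_of_seq hfin hP.interval hp hL
  have hseq : Infinite V → Γ.numEnds ≤ 2 →
      ∃ R : ℤ → V, Function.Bijective R ∧ ∃ M, ∀ i, Γ.dist (R i) (R (i + 1)) ≤ M :=
    fun _ h => hconn.exists_int_seq hfin (hconn.not_three_disjoint h)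
  have huniv : ∀ {R : ℤ → V}, Function.Bijective R →
      Function.Bijective fun i : (Set.univ : Set ℤ) => R i :=
    fun hR => hR.comp (Equiv.Set.univ ℤ).bijective
  have hjump : ∀ {R : ℤ → V} {M : ℕ}, (∀ i, Γ.dist (R i) (R (i + 1)) ≤ M) →
      ∀ i j : (Set.univ : Set ℤ), (j : ℤ) = i + 1 → Γ.dist (R i) (R j) ≤ M :=
    fun hM i j hij => hij ▸ hM i
  have hbi : Infinite V → Γ.numEnds ≤ 2 → ∃ (W : Type u) (Δ : SimpleGraph W),
      Γ.BilipschitzEquivalent Δ ∧ Δ.AdmitsBiinfiniteHamiltonianPath := by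
    intro hV h
    obtain ⟨R, hR, M, hM⟩ := hseq hV h
    obtain ⟨Δ, hΔ, hham⟩ :=
      hconn.exists_bilipschitzEquivalent_of_seq Set.ordConnected_univ (huniv hR) (hjump hM)
    exact ⟨V, Δ, hΔ, _, hham⟩
  refine ⟨⟨fun ⟨W, Δ, hΔ, h⟩ => hends hΔ h, fun h => ?_⟩, fun hV =>
    ⟨⟨fun ⟨W, Δ, hΔ, P, hP⟩ => hends hΔ ⟨_, P, hP⟩, hbi hV⟩, ?_⟩⟩
  · rcases finite_or_infinite V with hV | hV
    · exact ⟨V, hconn.exists_admitsHamiltonianPath_of_finite⟩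
    · obtain ⟨W, Δ, hΔ, P, hP⟩ := hbi hV h
      exact ⟨W, Δ, hΔ, _, P, hP⟩
  · rw [hconn.admitsTransitiveTranslationLikeIntAction_iff]
    refine ⟨fun ⟨R, hR, M, hM⟩ => ?_, hseq hV⟩
    exact hconn.numEnds_le_two_of_seq hfin Set.ordConnected_univ (huniv hR) (hjump hM)
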